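/- Let $P$ be a finite poset with $n$ elements, and let $e(P)$ be its number of linear extensions (order-preserving bijections $P\to\{1,\dots,n\}$). Let the antichain Greene–Kleitman–Fomin parameters $a_1,a_2,\dots$ of $P$ be defined by the condition that, for every $k\ge 0$, $a_1+\dots+a_k$ is the maximal number of elements of $P$ which may be covered by $k$ antichains. Then $$\frac{n!}{\prod_i c_i!}\ \ge\ e(P)\ \ge\ \prod_i a_i!,$$ where $c_1,c_2,\dots$ are the chain Greene–Kleitman–Fomin parameters of $P$. This holds for either of the two usual definitions of these parameters (which agree by the Greene–Kleitman–Fomin theorem): (i) for every $k\ge 0$, $c_1+\dots+c_k$ is the maximal number of elements of $P$ which may be covered by $k$ chains; (ii) $c_1,c_2,\dots$ are the parts of the partition conjugate to $n=a_1+a_2+\cdots$, that is, $c_j$ is the number of indices $i$ with $a_i\ge j$. -/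

import Mathlib

/-- The number `e(P)` of linear extensions of a finite poset `P`: the number of order-preserving
bijections from `P` onto an `n`-element chain, where `n` is the number of elements of `P`. -/
noncomputable def numLinearExtensions (P : Type*) [PartialOrder P] [Fintype P] : ℕ :=
  Nat.card {f : P ≃ Fin (Fintype.card P) // Monotone f}

/-- The maximal number of elements of `P` which may be covered by `k` sets having the
property `Q` (the `k` sets need not be disjoint, distinct or non-empty). -/
noncomputable def maxCover {P : Type*} (Q : Set P → Prop) (k : ℕ) : ℕ :=
  sSup {m : ℕ | ∃ A : Fin k → Set P, (∀ i, Q (A i)) ∧ (⋃ i, A i).ncard = m}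

/-- The maximal number of elements of `P` which may be covered by `k` antichains. -/
noncomputable def antichainCover (P : Type*) [PartialOrder P] (k : ℕ) : ℕ :=
  maxCover (fun A : Set P => IsAntichain (· ≤ ·) A) k

/-- The maximal number of elements of `P` which may be covered by `k` chains. -/
noncomputable def chainCover (P : Type*) [PartialOrder P] (k : ℕ) : ℕ :=
  maxCover (fun C : Set P => IsChain (· ≤ ·) C) k

/-- The antichain parameters, indexed from `0`: `antichainParam P i` is `a_{i+1}`. The lemma
`sum_antichainParam` below says that `a_1 + ... + a_k` is the maximal number of elements
covered by `k` antichains, so no truncation occurs in the subtraction. -/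
noncomputable def antichainParam (P : Type*) [PartialOrder P] (i : ℕ) : ℕ :=
  antichainCover P (i + 1) - antichainCover P i

/-- The chain parameters, defined by chain coverings and indexed from `0`: `chainParam P i` is
`c_{i+1}`. See `sum_chainParam` below. -/
noncomputable def chainParam (P : Type*) [PartialOrder P] (i : ℕ) : ℕ :=
  chainCover P (i + 1) - chainCover P i

/-- The parts of the partition conjugate to the partition of `n` into the antichain parameters,
indexed from `0`: the part with index `j` is the number of the `a_i` which are at least `j + 1`.
(All `a_i` with `i > n` vanish, see `antichainParam_eq_zero`.) -/
noncomputable def conjAntichainParam (P : Type*) [PartialOrder P] [Fintype P] (j : ℕ) : ℕ :=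
  ((Finset.range (Fintype.card P)).filter (fun i => j + 1 ≤ antichainParam P i)).card

/-- The supremum defining `maxCover` is a maximum. -/
theorem maxCover_isGreatest {P : Type*} [Fintype P] (Q : Set P → Prop) (h0 : Q ∅) (k : ℕ) :
    IsGreatest {m : ℕ | ∃ A : Fin k → Set P, (∀ i, Q (A i)) ∧ (⋃ i, A i).ncard = m}
      (maxCover Q k) := by
  have hb : BddAbove {m : ℕ | ∃ A : Fin k → Set P, (∀ i, Q (A i)) ∧ (⋃ i, A i).ncard = m} := by
    refine ⟨Nat.card P, ?_⟩
    rintro m ⟨A, -, rfl⟩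
    exact Set.ncard_le_card _
  refine ⟨Nat.sSup_mem ⟨_, fun _ => ∅, fun _ => h0, rfl⟩ hb, fun m hm => le_csSup hb hm⟩

theorem maxCover_zero {P : Type*} [Fintype P] (Q : Set P → Prop) (h0 : Q ∅) :
    maxCover Q 0 = 0 := by
  obtain ⟨A, -, hA⟩ := (maxCover_isGreatest Q h0 0).1
  simpa using hA.symm

theorem maxCover_mono {P : Type*} [Fintype P] (Q : Set P → Prop) (h0 : Q ∅) :
    Monotone (maxCover Q) := by
  refine monotone_nat_of_le_succ fun k => ?_
  obtain ⟨A, hQ, hA⟩ := (maxCover_isGreatest Q h0 k).1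
  refine (maxCover_isGreatest Q h0 (k + 1)).2 ⟨Fin.cons ∅ A, ?_, ?_⟩
  · intro i
    refine Fin.cases ?_ (fun j => ?_) i
    · simpa using h0
    · simpa using hQ j
  · rw [← hA]
    congr 1
    ext x
    simp

theorem sum_maxCover_sub {P : Type*} [Fintype P] (Q : Set P → Prop) (h0 : Q ∅) (k : ℕ) :
    ∑ i ∈ Finset.range k, (maxCover Q (i + 1) - maxCover Q i) = maxCover Q k := by
  rw [Finset.sum_range_tsub (maxCover_mono Q h0), maxCover_zero Q h0, Nat.sub_zero]

theorem maxCover_eq_card {P : Type*} [Fintype P] (Q : Set P → Prop) (h0 : Q ∅)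
    (h1 : ∀ x, Q {x}) (k : ℕ) (hk : Fintype.card P ≤ k) : maxCover Q k = Fintype.card P := by
  apply le_antisymm
  · obtain ⟨A, -, hA⟩ := (maxCover_isGreatest Q h0 k).1
    rw [← hA, ← Nat.card_eq_fintype_card]
    exact Set.ncard_le_card _
  · refine le_trans ?_ (maxCover_mono Q h0 hk)
    refine (maxCover_isGreatest Q h0 _).2
      ⟨fun i => {(Fintype.equivFin P).symm i}, fun i => h1 _, ?_⟩
    have : (⋃ i, {(Fintype.equivFin P).symm i}) = (Set.univ : Set P) := by
      ext x
      simp only [Set.mem_iUnion, Set.mem_singleton_iff, Set.mem_univ, iff_true]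
      exact ⟨Fintype.equivFin P x, by simp⟩
    rw [this, Set.ncard_univ, Nat.card_eq_fintype_card]

/-- `a_1 + ... + a_k` is the maximal number of elements covered by `k` antichains. -/
theorem sum_antichainParam (P : Type*) [PartialOrder P] [Fintype P] (k : ℕ) :
    ∑ i ∈ Finset.range k, antichainParam P i = antichainCover P k :=
  sum_maxCover_sub _ (Set.pairwise_empty _) k

/-- `c_1 + ... + c_k` is the maximal number of elements covered by `k` chains. -/
theorem sum_chainParam (P : Type*) [PartialOrder P] [Fintype P] (k : ℕ) :
    ∑ i ∈ Finset.range k, chainParam P i = chainCover P k :=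
  sum_maxCover_sub _ (Set.pairwise_empty _) k

/-- Only the first `n` antichain parameters can be non-zero. -/
theorem antichainParam_eq_zero (P : Type*) [PartialOrder P] [Fintype P] (i : ℕ)
    (hi : Fintype.card P ≤ i) : antichainParam P i = 0 := by
  unfold antichainParam antichainCover
  rw [maxCover_eq_card _ (Set.pairwise_empty _) (fun x => Set.pairwise_singleton x _) i hi,
    maxCover_eq_card _ (Set.pairwise_empty _) (fun x => Set.pairwise_singleton x _) (i + 1) (by omega),
    Nat.sub_self]

/-- Only the first `n` chain parameters can be non-zero. -/
theorem chainParam_eq_zero (P : Type*) [PartialOrder P] [Fintype P] (i : ℕ)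
    (hi : Fintype.card P ≤ i) : chainParam P i = 0 := by
  unfold chainParam chainCover
  rw [maxCover_eq_card _ (Set.pairwise_empty _) (fun x => Set.pairwise_singleton x _) i hi,
    maxCover_eq_card _ (Set.pairwise_empty _) (fun x => Set.pairwise_singleton x _) (i + 1) (by omega),
    Nat.sub_self]

/-! Both bounds are proved by induction, deleting one element x from a subset S. Write A_k and C_l
for the cover numbers of S by antichains and chains, and e for the number of linear extensions. Two
facts about e are used: e(S) is the sum of e(S∖x) over the minimal x (`numLabelings_eq_sum`), and
the sum of e(S∖x) over any antichain is at most e(S) (`sum_numLabelings_erase_le`).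

Deletion lowers each cover number by 0 or 1. As the parameters decrease, `prod_factorial_le_of_box`
shows that the product of their factorials shrinks by a factor of at most one parameter of S, whose
index may be any point up to which no cover number has dropped.

Lower bound: for x in a maximum antichain the factor is at most a_1, and summing over its a_1
elements gives the claim. Upper bound: for minimal x the factor is the chain parameter at the first
drop s(x). At most k minimal elements have s(x) < k, so these parameters sum to at most c_1 + c_2 +
... = n, which turns (n-1)! into n!. Here a drop of C_k must persist for larger k
(`chainCover_erase_add_one_of_le`); this is carried over by duality from the same statement for A_k,
where it follows from an exchange inequality for monotone functions (`ncard_strictRises_add_le`).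

That the parameters decrease and are conjugate rests on Greene–Kleitman–Fomin duality: A_k + C_l ≤ n
+ kl always, and each k, like each l, has a partner giving equality. The equality comes from
integral duality for an assignment problem. -/

/-! ### Integral duality for the assignment problem -/

/-- Egerváry's theorem: potentials of least total value have enough tight edges for Hall's
condition. Loops are allowed edges, so the identity bounds the total value from below. -/
theorem exists_perm_tight_cover {X : Type*} [Fintype X] [DecidableEq X] (w : X → X → ℤ)
    (E : X → X → Prop) (hE : ∀ x, E x x) :
    ∃ (u v : X → ℤ) (σ : Equiv.Perm X), (∀ x y, E x y → w x y ≤ u x + v y) ∧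
      ∀ x, E x (σ x) ∧ w x (σ x) = u x + v (σ x) := by
  classical
  let F : Set ((X → ℤ) × (X → ℤ)) := {c | ∀ x y, E x y → w x y ≤ c.1 x + c.2 y}
  let val : (X → ℤ) × (X → ℤ) → ℤ := fun c => ∑ x, c.1 x + ∑ x, c.2 x
  have hval : ∀ c ∈ F, ∑ x, w x x ≤ val c := by
    intro c hc
    simp only [val, ← Finset.sum_add_distrib]
    exact Finset.sum_le_sum fun x _ => hc x x (hE x)
  have hne : F.Nonempty := by
    refine ⟨(fun x => ∑ y, |w x y|, fun _ => 0), fun x y _ => ?_⟩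
    have : |w x y| ≤ ∑ z, |w x z| :=
      Finset.single_le_sum (f := fun z => |w x z|) (fun z _ => abs_nonneg _) (Finset.mem_univ y)
    simpa using (le_abs_self _).trans this
  have hmin : ∃ c ∈ F, ∀ c' ∈ F, val c ≤ val c' := by
    have hex : ∃ m : ℕ, ∃ c ∈ F, val c - ∑ x, w x x = m := by
      obtain ⟨c, hc⟩ := hne
      exact ⟨(val c - ∑ x, w x x).toNat, c, hc, by have := hval c hc; omega⟩
    obtain ⟨c, hc, hm⟩ := Nat.find_spec hex
    refine ⟨c, hc, fun c' hc' => ?_⟩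
    have h1 := hval c' hc'
    have := Nat.find_min' hex (m := (val c' - ∑ x, w x x).toNat) ⟨c', hc', by omega⟩
    omega
  obtain ⟨c, hc, hmin⟩ := hmin
  obtain ⟨u, v⟩ := c
  let t : X → Finset X := fun x => Finset.univ.filter fun y => E x y ∧ w x y = u x + v y
  have hall : ∀ s : Finset X, s.card ≤ (s.biUnion t).card := by
    intro s
    by_contra! hlt
    -- A Hall violator s would allow a cheaper cover: lower u by 1 on s and raise v by 1 on the
    -- tight neighbours of s. Non-tight edges have slack at least 1 by integrality.
    have := hmin (fun x => u x - if x ∈ s then 1 else 0,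
      fun y => v y + if y ∈ s.biUnion t then 1 else 0) (by
        intro x y hxy
        have h1 := hc x y hxy
        by_cases hx : x ∈ s
        · by_cases hy : y ∈ s.biUnion t
          · simpa [hx, hy] using h1
          · have : w x y ≠ u x + v y := fun h =>
              hy (Finset.mem_biUnion.2 ⟨x, hx, Finset.mem_filter.2 ⟨Finset.mem_univ _, hxy, h⟩⟩)
            simp only [hx, hy, if_true, if_false]
            simp only at h1
            omega
        · simp only [hx, if_false]
          simp only at h1
          split_ifs <;> omega)
    simp only [val, Finset.sum_sub_distrib, Finset.sum_add_distrib, Finset.sum_boole,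
      Finset.filter_mem_eq_inter, Finset.univ_inter] at this
    omega
  obtain ⟨f, hf, hft⟩ := (Finset.all_card_le_biUnion_card_iff_exists_injective t).1 hall
  refine ⟨u, v, Equiv.ofBijective f (Finite.injective_iff_bijective.1 hf), hc, fun x => ?_⟩
  exact (Finset.mem_filter.1 (hft x)).2

theorem le_maxCover_of_fintype {P ι : Type*} [Fintype P] [Fintype ι] {Q : Set P → Prop}
    (h0 : Q ∅) {k : ℕ} (hk : Fintype.card ι ≤ k) (A : ι → Set P) (hA : ∀ i, Q (A i))
    {B : Set P} (hB : B ⊆ ⋃ i, A i) : B.ncard ≤ maxCover Q k := by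
  refine le_trans (Set.ncard_le_ncard hB (Set.toFinite _)) (le_trans ?_ (maxCover_mono Q h0 hk))
  refine (maxCover_isGreatest Q h0 _).2 ⟨fun i => A ((Fintype.equivFin ι).symm i), fun i => hA _, ?_⟩
  exact congrArg Set.ncard ((Fintype.equivFin ι).symm.surjective.iUnion_comp A)

theorem exists_maxCover {P : Type*} [Fintype P] {Q : Set P → Prop} (h0 : Q ∅) (k : ℕ) :
    ∃ A : Fin k → Set P, (∀ i, Q (A i)) ∧ (⋃ i, A i).ncard = maxCover Q k :=
  (maxCover_isGreatest Q h0 k).1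

/-! ### Greene–Kleitman–Fomin duality -/

section Duality

variable {T : Type*} [PartialOrder T] [Fintype T]

theorem le_antichainCover {ι : Type*} [Fintype ι] {k : ℕ} (hk : Fintype.card ι ≤ k)
    (A : ι → Set T) (hA : ∀ i, IsAntichain (· ≤ ·) (A i)) {B : Set T} (hB : B ⊆ ⋃ i, A i) :
    B.ncard ≤ antichainCover T k :=
  le_maxCover_of_fintype (Set.pairwise_empty _) hk A hA hB

theorem le_chainCover {ι : Type*} [Fintype ι] {k : ℕ} (hk : Fintype.card ι ≤ k)
    (A : ι → Set T) (hA : ∀ i, IsChain (· ≤ ·) (A i)) {B : Set T} (hB : B ⊆ ⋃ i, A i) :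
    B.ncard ≤ chainCover T k :=
  le_maxCover_of_fintype (Set.pairwise_empty _) hk A hA hB

/-- A chain and an antichain share at most one element, so the two unions overlap in at most kl
elements. -/
theorem antichainCover_add_chainCover_le (k l : ℕ) :
    antichainCover T k + chainCover T l ≤ Fintype.card T + k * l := by
  classical
  obtain ⟨A, hA, hAc⟩ := exists_maxCover (P := T) (Q := fun A => IsAntichain (· ≤ ·) A)
    (Set.pairwise_empty _) k
  obtain ⟨C, hC, hCc⟩ := exists_maxCover (P := T) (Q := fun A => IsChain (· ≤ ·) A)
    (Set.pairwise_empty _) l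
  rw [antichainCover, chainCover, ← hAc, ← hCc,
    ← Set.ncard_union_add_ncard_inter _ _ (Set.toFinite _) (Set.toFinite _)]
  refine add_le_add ((Set.ncard_le_card _).trans_eq Nat.card_eq_fintype_card) ?_
  have h : ∀ x : ↥((⋃ i, A i) ∩ ⋃ i, C i), ∃ p : Fin k × Fin l, x.1 ∈ A p.1 ∧ x.1 ∈ C p.2 := by
    rintro ⟨x, hx, hx'⟩
    obtain ⟨i, hi⟩ := Set.mem_iUnion.1 hx
    obtain ⟨j, hj⟩ := Set.mem_iUnion.1 hx'
    exact ⟨(i, j), hi, hj⟩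
  choose f hf using h
  have hinj : Function.Injective f := by
    intro x y hxy
    by_contra hne
    have hne' : x.1 ≠ y.1 := fun h => hne (Subtype.ext h)
    have hx := hf x
    have hy := hf y
    rw [hxy] at hx
    rcases hC _ hx.2 hy.2 hne' with h | h
    · exact hA _ hx.1 hy.1 hne' h
    · exact hA _ hy.1 hx.1 hne'.symm h
  have := Nat.card_le_card_of_injective f hinj
  rw [Nat.card_coe_set_eq] at this
  simpa using this

theorem antichainCover_add_le (k m : ℕ) :
    antichainCover T (k + m) ≤ antichainCover T k + m * Fintype.card T := by
  classical
  obtain ⟨A, hA, hAc⟩ := exists_maxCover (P := T) (Q := fun A => IsAntichain (· ≤ ·) A)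
    (Set.pairwise_empty _) (k + m)
  have hU : (⋃ i, A i) ⊆ (⋃ i, A (Fin.castAdd m i)) ∪ ⋃ i, A (Fin.natAdd k i) := by
    intro x hx
    obtain ⟨i, hi⟩ := Set.mem_iUnion.1 hx
    induction i using Fin.addCases with
    | left i => exact Or.inl (Set.mem_iUnion.2 ⟨i, hi⟩)
    | right i => exact Or.inr (Set.mem_iUnion.2 ⟨i, hi⟩)
  have h1 := (Set.ncard_le_ncard hU (Set.toFinite _)).trans (Set.ncard_union_le _ _)
  have h2 : (⋃ i, A (Fin.castAdd m i)).ncard ≤ antichainCover T k :=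
    le_antichainCover (by simp) (fun i => A (Fin.castAdd m i)) (fun i => hA _) subset_rfl
  have h3 : (⋃ i, A (Fin.natAdd k i)).ncard ≤ m * Fintype.card T := by
    rcases Nat.eq_zero_or_pos m with rfl | hm
    · simp
    · refine (Set.ncard_le_card _).trans ?_
      rw [Nat.card_eq_fintype_card]
      exact Nat.le_mul_of_pos_left _ hm
  rw [antichainCover, ← hAc]
  omega

/-- A permutation of `T ⊕ Fin N` which moves the elements of `T` upwards decomposes the elements
that it moves into chains, one for every element that it sends out of `T`. -/
theorem ncard_moved_le_chainCover {N : ℕ} (σ : Equiv.Perm (T ⊕ Fin N))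
    (hσ : ∀ p q, σ (Sum.inl p) = Sum.inl q → p ≤ q) :
    {p : T | σ (Sum.inl p) ≠ Sum.inl p}.ncard ≤
      chainCover T {p : T | (σ (Sum.inl p)).isRight}.ncard := by
  classical
  let r : T → T → Prop := fun p q => σ (Sum.inl p) = Sum.inl q
  have hle : ∀ {p q}, Relation.ReflTransGen r p q → p ≤ q := by
    intro p q h
    induction h with
    | refl => exact le_rfl
    | tail _ h ih => exact ih.trans (hσ _ _ h)
  refine le_chainCover (ι := {p : T | (σ (Sum.inl p)).isRight}) ?_
    (fun p => {q | Relation.ReflTransGen r q p.1}) ?_ ?_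
  · rw [← Nat.card_eq_fintype_card, Nat.card_coe_set_eq]
  · intro p q₁ h₁ q₂ h₂ _
    -- Predecessors under σ are unique, so the elements leading to a given exit form a single
    -- backward path.
    have hu : Relator.RightUnique (Function.swap r) := by
      intro a b c hb hc
      exact Sum.inl_injective (σ.injective ((show σ (Sum.inl b) = _ from hb).trans
        (show σ (Sum.inl c) = _ from hc).symm))
    rcases Relation.ReflTransGen.total_of_right_unique hu h₁.swap h₂.swap with h | h
    · exact Or.inr (hle h.swap)
    · exact Or.inl (hle h.swap)
  · intro p
    -- A moved element rises strictly until its path leaves T; it cannot run into a fixed point,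
    -- whose only preimage is itself.
    induction p using WellFoundedGT.induction with
    | ind p ih =>
      intro hp
      rcases h : σ (Sum.inl p) with q | d
      · have hpq : p ≠ q := by
          rintro rfl
          exact hp h
        have hq : σ (Sum.inl q) ≠ Sum.inl q := fun hq =>
          hpq (Sum.inl_injective (σ.injective (h.trans hq.symm)))
        obtain ⟨t, ht⟩ := Set.mem_iUnion.1 (ih q (lt_of_le_of_ne (hσ p q h) hpq) hq)
        exact Set.mem_iUnion.2 ⟨t, Relation.ReflTransGen.head h ht⟩
      · exact Set.mem_iUnion.2 ⟨⟨p, by simp [h]⟩, Relation.ReflTransGen.refl⟩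

/-- Only elements with U + V = K - 1 contribute positively to the left side, and each contributes 1.
On them U takes values in {0, ..., K - 1}, and its level sets are antichains, since p < q at the
same level would give U p + V q = K - 1. -/
theorem sub_sum_le_antichainCover (K : ℕ) (U V : T → ℤ) (hU : ∀ p, 0 ≤ U p) (hV : ∀ p, 0 ≤ V p)
    (h : ∀ p q, p < q → K ≤ U p + V q) (h' : ∀ p, (K : ℤ) - 1 ≤ U p + V p) :
    (Fintype.card T : ℤ) * K - ∑ p, (U p + V p) ≤ antichainCover T K := by
  classical
  have h1 : {p | U p + V p = (K : ℤ) - 1}.ncard ≤ antichainCover T K := by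
    refine le_antichainCover (ι := Fin K) (by simp)
      (fun i => {p | U p = (i : ℕ) ∧ U p + V p = (K : ℤ) - 1}) ?_ ?_
    · intro i p hp q hq hne hle
      have := h p q (lt_of_le_of_ne hle hne)
      have h2 := hp.1
      have h3 := hp.2
      have h4 := hq.1
      have h5 := hq.2
      omega
    · intro p hp
      have hp' : U p + V p = (K : ℤ) - 1 := hp
      have := hU p
      have := hV p
      exact Set.mem_iUnion.2 ⟨⟨(U p).toNat, by omega⟩, by simp only [Set.mem_ofPred_eq]; omega⟩
  have h2 : ∑ p, ((K : ℤ) - (U p + V p)) ≤ ∑ p, if U p + V p = (K : ℤ) - 1 then 1 else 0 := by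
    refine Finset.sum_le_sum fun p _ => ?_
    have := h' p
    split_ifs <;> omega
  rw [Finset.sum_boole, Finset.sum_sub_distrib, Finset.sum_const, nsmul_eq_mul,
    Finset.card_univ] at h2
  have h3 : {p | U p + V p = (K : ℤ) - 1}.ncard =
      (Finset.univ.filter fun p => U p + V p = (K : ℤ) - 1).card := by
    rw [← Set.ncard_coe_finset]
    simp
  rw [h3] at h1
  have : ((Finset.univ.filter fun p => U p + V p = (K : ℤ) - 1).card : ℤ) ≤ antichainCover T K := by
    exact_mod_cast h1
  linarith

/-- One assignment problem on T with N dummy points produces both families. Staying put earns 0,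
moving up earns 1, and leaving T for a dummy earns 1 - κ. An optimal permutation with t exits gives
t chains; the optimal potentials give κ + β antichains. -/
theorem exists_add_le_antichainCover_add_chainCover (N κ : ℕ) (hN : 0 < N) :
    ∃ β t : ℕ, t ≤ N ∧
      Fintype.card T + κ * t + N * β ≤ antichainCover T (κ + β) + chainCover T t := by
  classical
  let E : T ⊕ Fin N → T ⊕ Fin N → Prop := fun x y =>
    ∀ p q, x = Sum.inl p → y = Sum.inl q → p ≤ q
  let w : T ⊕ Fin N → T ⊕ Fin N → ℤ := fun x y => match x, y with
    | Sum.inl p, Sum.inl q => if p = q then 0 else 1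
    | Sum.inl _, Sum.inr _ => 1 - κ
    | Sum.inr _, _ => 0
  obtain ⟨u, v, σ, huv, hσ⟩ := exists_perm_tight_cover w E (by
    rintro x p q rfl h
    rw [Sum.inl_injective h])
  have : Nonempty (Fin N) := ⟨⟨0, hN⟩⟩
  obtain ⟨d₁, hd₁⟩ := Finite.exists_min fun d : Fin N => u (Sum.inr d)
  obtain ⟨d₂, hd₂⟩ := Finite.exists_min fun d : Fin N => v (Sum.inr d)
  have hdd : 0 ≤ u (Sum.inr d₁) + v (Sum.inr d₂) := huv (Sum.inr d₁) (Sum.inr d₂) (by simp [E])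
  obtain ⟨β, hβ⟩ := Int.eq_ofNat_of_zero_le hdd
  have hmoved := ncard_moved_le_chainCover σ (fun p q h => (hσ (Sum.inl p)).1 p q rfl h)
  set t := {p : T | (σ (Sum.inl p)).isRight}.ncard with ht
  have htN : t ≤ N := by
    have hch : ∀ p : ↥{p : T | (σ (Sum.inl p)).isRight}, ∃ d, σ (Sum.inl p.1) = Sum.inr d := by
      intro p
      exact Sum.isRight_iff.1 p.2
    choose f hf using hch
    have := Nat.card_le_card_of_injective f (fun p q h => by
      have := (hf p).trans ((congrArg Sum.inr h).trans (hf q).symm)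
      exact Subtype.ext (Sum.inl_injective (σ.injective this)))
    rw [Nat.card_coe_set_eq] at this
    simpa using this
  refine ⟨β, t, htN, ?_⟩
  -- The shifts add up to κ + β - 1, so weight 1 for p < q becomes the bound K = κ + β and weight 0
  -- on the diagonal becomes K - 1. Nonnegativity is the cover condition for the edges into `d₂` and
  -- out of `d₁`.
  have hdual := sub_sum_le_antichainCover (T := T) (κ + β)
    (fun p => u (Sum.inl p) + v (Sum.inr d₂) + κ - 1) (fun p => v (Sum.inl p) + u (Sum.inr d₁))
    (fun p => by
      have : (1 : ℤ) - κ ≤ u (Sum.inl p) + v (Sum.inr d₂) :=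
        huv (Sum.inl p) (Sum.inr d₂) (by simp [E])
      linarith)
    (fun p => by
      have : 0 ≤ u (Sum.inr d₁) + v (Sum.inl p) := huv (Sum.inr d₁) (Sum.inl p) (by simp [E])
      linarith)
    (fun p q hpq => by
      have := huv (Sum.inl p) (Sum.inl q) (by
        intro a b ha hb
        rw [← Sum.inl_injective ha, ← Sum.inl_injective hb]
        exact hpq.le)
      simp only [w, hpq.ne, if_false] at this
      push_cast
      linarith)
    (fun p => by
      have := huv (Sum.inl p) (Sum.inl p) (by
        intro a b ha hb
        rw [← Sum.inl_injective ha, ← Sum.inl_injective hb])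
      simp only [w, if_true] at this
      push_cast
      linarith)
  have hsum : ∑ x, w x (σ x) = ∑ x, u x + ∑ x, v x := by
    rw [← Equiv.sum_comp σ v, ← Finset.sum_add_distrib]
    exact Finset.sum_congr rfl fun x _ => (hσ x).2
  simp only [Fintype.sum_sum_type] at hsum
  have hw : ∑ p, w (Sum.inl p) (σ (Sum.inl p)) =
      {p : T | σ (Sum.inl p) ≠ Sum.inl p}.ncard - κ * t := by
    have h1 : ∀ p, w (Sum.inl p) (σ (Sum.inl p)) =
        (if σ (Sum.inl p) ≠ Sum.inl p then 1 else 0) - κ * if (σ (Sum.inl p)).isRight then 1 else 0 := by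
      intro p
      rcases h : σ (Sum.inl p) with q | d
      · by_cases hpq : p = q
        · simp [w, hpq]
        · have : q ≠ p := fun h => hpq h.symm
          simp [w, hpq, this]
      · simp [w]
    rw [Finset.sum_congr rfl fun p _ => h1 p, Finset.sum_sub_distrib, ← Finset.mul_sum,
      Finset.sum_boole, Finset.sum_boole, ht, ← Set.ncard_coe_finset, ← Set.ncard_coe_finset]
    simp
  have hw' : ∑ d, w (Sum.inr d) (σ (Sum.inr d)) = 0 := by simp [w]
  have hd : (N : ℤ) * β ≤ ∑ d, u (Sum.inr d) + ∑ d, v (Sum.inr d) := by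
    rw [← Finset.sum_add_distrib]
    have : ∑ _d : Fin N, (β : ℤ) ≤ ∑ d, (u (Sum.inr d) + v (Sum.inr d)) := by
      refine Finset.sum_le_sum fun d _ => ?_
      have := hd₁ d
      have := hd₂ d
      linarith
    simpa using this
  simp only [Finset.sum_add_distrib, Finset.sum_sub_distrib, Finset.sum_const, nsmul_eq_mul,
    Finset.card_univ] at hdual
  rw [hw, hw'] at hsum
  have hm : ({p : T | σ (Sum.inl p) ≠ Sum.inl p}.ncard : ℤ) ≤ chainCover T t := by
    exact_mod_cast hmoved
  have hz : (Fintype.card T : ℤ) + κ * t + N * β ≤ antichainCover T (κ + β) + chainCover T t := by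
    have : (Fintype.card T : ℤ) * v (Sum.inr d₂) + Fintype.card T * u (Sum.inr d₁) =
      Fintype.card T * β := by rw [← hβ]; ring
    push_cast at hdual
    linarith
  exact_mod_cast hz

theorem exists_chainCover_dual (k : ℕ) :
    ∃ l, Fintype.card T + k * l ≤ antichainCover T k + chainCover T l := by
  rcases Nat.eq_zero_or_pos (Fintype.card T) with h | h
  · exact ⟨0, by simp [h]⟩
  -- With |T| dummies, the surplus |T|β on the left absorbs whatever β further antichains can cover.
  · obtain ⟨β, t, -, ht⟩ := exists_add_le_antichainCover_add_chainCover (T := T) _ k h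
    have := antichainCover_add_le (T := T) k β
    rw [mul_comm] at this
    exact ⟨t, by omega⟩

theorem exists_antichainCover_dual (l : ℕ) :
    ∃ k, Fintype.card T + k * l ≤ antichainCover T k + chainCover T l := by
  rcases Nat.eq_zero_or_pos l with rfl | h
  · refine ⟨Fintype.card T, ?_⟩
    have : antichainCover T (Fintype.card T) = Fintype.card T :=
      maxCover_eq_card _ (Set.pairwise_empty _) (fun x => Set.pairwise_singleton x _) _ le_rfl
    simp [this]
  -- With κ = 0, β itself is the number of antichains, and l dummies allow at most l chains.
  · obtain ⟨β, t, htl, ht⟩ := exists_add_le_antichainCover_add_chainCover (T := T) l 0 h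
    have : chainCover T t ≤ chainCover T l := maxCover_mono _ (Set.pairwise_empty _) htl
    rw [zero_add, mul_comm l] at ht
    exact ⟨β, by omega⟩

end Duality

/-! ### Numerical consequences of duality, and two inequalities for decreasing sequences -/

section Numeric

/-- A partner l of k + 1 separates consecutive differences: the one ending at k + 1 is at least l,
the one starting there at most l. -/
theorem antitone_sub_of_dual {A C : ℕ → ℕ} {n : ℕ} (hw : ∀ k l, A k + C l ≤ n + k * l)
    (hd : ∀ k, ∃ l, n + k * l ≤ A k + C l) : Antitone fun i => A (i + 1) - A i := by
  refine antitone_nat_of_succ_le fun k => ?_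
  obtain ⟨l, hl⟩ := hd (k + 1)
  have h1 := hw k l
  have h2 := hw (k + 1 + 1) l
  simp only [add_mul, one_mul] at *
  omega

theorem add_mul_le_of_antitone_sub {A : ℕ → ℕ} (hA : Monotone A)
    (ha : Antitone fun i => A (i + 1) - A i) {k j : ℕ} (hkj : k ≤ j) {x : ℕ}
    (hx : x ≤ A (j + 1) - A j) : A k + (j + 1 - k) * x ≤ A (j + 1) := by
  have h : ∀ m, m ≤ j + 1 - k → A k + m * x ≤ A (k + m) := by
    intro m
    induction m with
    | zero => simp
    | succ m ih =>
      intro hm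
      have h1 := ih (by omega)
      have h2 : A (j + 1) - A j ≤ A (k + m + 1) - A (k + m) := ha (by omega)
      have h3 : A (k + m) ≤ A (k + m + 1) := hA (Nat.le_succ (k + m))
      rw [add_mul, one_mul, ← add_assoc k m 1]
      omega
  have := h (j + 1 - k) le_rfl
  rwa [show k + (j + 1 - k) = j + 1 by omega] at this

/-- If C grew by at most j at i, a partner k of i + 1 would satisfy k ≤ j. Concavity gives A (j + 1)
≥ A k + (j + 1 - k)(i + 1), and weak duality at (j + 1, i) then forces C to grow by j + 1. -/
theorem succ_le_sub_of_dual {A C : ℕ → ℕ} {n : ℕ} (hA : Monotone A)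
    (ha : Antitone fun i => A (i + 1) - A i) (hw : ∀ k l, A k + C l ≤ n + k * l)
    (hd : ∀ l, ∃ k, n + k * l ≤ A k + C l) {i j : ℕ} (h : i + 1 ≤ A (j + 1) - A j) :
    j + 1 ≤ C (i + 1) - C i := by
  by_contra! hlt
  obtain ⟨k, hk⟩ := hd (i + 1)
  have h1 := hw k i
  have h2 : k ≤ j := by
    rw [mul_add, mul_one] at hk
    omega
  have h3 := add_mul_le_of_antitone_sub hA ha h2 h
  have h4 := hw (j + 1) i
  have h5 : (j + 1 - k) * (i + 1) + k * (i + 1) = (j + 1) * (i + 1) := by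
    rw [← add_mul]
    congr 1
    omega
  have h6 : (j + 1) * (i + 1) = (j + 1) * i + (j + 1) := by ring
  omega

/-- For Young diagrams differing in one box this is immediate. Here L - M may switch between 0 and 1
repeatedly, so the induction carries an extra factor, the next difference of L, while L = M. A step
from 0 to 1 spends it; a step back restores it, because the differences of L decrease. -/
theorem prod_factorial_le_of_box {L M : ℕ → ℕ} (hL : Monotone L) (hM : Monotone M)
    (hl : Antitone fun i => L (i + 1) - L i) (h1 : ∀ k, M k ≤ L k) (h2 : ∀ k, L k ≤ M k + 1)
    {s N : ℕ} (hsN : s ≤ N) (hs : ∀ k ≤ s, M k = L k) (hN : M N + 1 = L N) :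
    ∏ i ∈ Finset.range N, (L (i + 1) - L i).factorial ≤
      (∏ i ∈ Finset.range N, (M (i + 1) - M i).factorial) * (L (s + 1) - L s) := by
  have key : ∀ k, s ≤ k →
      (M k = L k → (∏ i ∈ Finset.range k, (L (i + 1) - L i).factorial) * (L (k + 1) - L k) ≤
        (∏ i ∈ Finset.range k, (M (i + 1) - M i).factorial) * (L (s + 1) - L s)) ∧
      (M k + 1 = L k → ∏ i ∈ Finset.range k, (L (i + 1) - L i).factorial ≤
        (∏ i ∈ Finset.range k, (M (i + 1) - M i).factorial) * (L (s + 1) - L s)) := by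
    intro k hk
    induction k, hk using Nat.le_induction with
    | base =>
      refine ⟨fun _ => le_of_eq ?_, fun h => ?_⟩
      · congr 1
        refine Finset.prod_congr rfl fun i hi => ?_
        have := Finset.mem_range.1 hi
        rw [hs i (by omega), hs (i + 1) (by omega)]
      · have := hs s le_rfl
        omega
    | succ k hk ih =>
      simp only [Finset.prod_range_succ]
      set p := ∏ i ∈ Finset.range k, (L (i + 1) - L i).factorial
      set q := ∏ i ∈ Finset.range k, (M (i + 1) - M i).factorial
      have hmL := hL (Nat.le_succ k)
      have hmM := hM (Nat.le_succ k)
      have a1 := h1 k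
      have a2 := h2 k
      have anti : L (k + 1 + 1) - L (k + 1) ≤ L (k + 1) - L k := hl (Nat.le_succ k)
      simp only [Nat.succ_eq_add_one] at hmL hmM
      set x := L (k + 1) - L k with hx
      set y := M (k + 1) - M k with hy
      set z := L (s + 1) - L s
      rcases Nat.lt_or_ge (M k) (L k) with hk0 | hk0
      · have hP := ih.2 (by omega)
        refine ⟨fun h => ?_, fun h => ?_⟩
        · have hyx : y = x + 1 := by omega
          calc p * x.factorial * (L (k + 1 + 1) - L (k + 1))
              ≤ p * x.factorial * (x + 1) := Nat.mul_le_mul_left _ (by omega)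
            _ = p * y.factorial := by rw [hyx, Nat.factorial_succ]; ring
            _ ≤ q * z * y.factorial := Nat.mul_le_mul_right _ hP
            _ = q * y.factorial * z := by ring
        · have hyx : y = x := by omega
          rw [hyx]
          calc p * x.factorial ≤ q * z * x.factorial := Nat.mul_le_mul_right _ hP
            _ = q * x.factorial * z := by ring
      · have hP := ih.1 (by omega)
        refine ⟨fun h => ?_, fun h => ?_⟩
        · have hyx : y = x := by omega
          rw [hyx]
          calc p * x.factorial * (L (k + 1 + 1) - L (k + 1))
              ≤ p * x.factorial * x := Nat.mul_le_mul_left _ anti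
            _ = p * x * x.factorial := by ring
            _ ≤ q * z * x.factorial := Nat.mul_le_mul_right _ hP
            _ = q * x.factorial * z := by ring
        · have hyx : x = y + 1 := by omega
          calc p * x.factorial = p * x * y.factorial := by
                rw [hyx, Nat.factorial_succ]; ring
            _ ≤ q * z * y.factorial := Nat.mul_le_mul_right _ hP
            _ = q * y.factorial * z := by ring
  exact (key N hsN).2 hN

theorem sum_antitone_comp_le {α : Type*} (X : Finset α) (s : α → ℕ) {c : ℕ → ℕ} (hc : Antitone c)
    (hs : ∀ k, (X.filter fun x => s x < k).card ≤ k) {N : ℕ} (hN : ∀ x ∈ X, s x < N) :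
    ∑ x ∈ X, c (s x) ≤ ∑ i ∈ Finset.range N, c i := by
  classical
  -- The unused slots below k are credited at the current price c k, which only falls as k grows.
  have key : ∀ k, ∑ x ∈ X.filter (fun x => s x < k), c (s x) +
      (k - (X.filter fun x => s x < k).card) * c k ≤ ∑ i ∈ Finset.range k, c i := by
    intro k
    induction k with
    | zero => simp
    | succ k ih =>
      have hsplit : X.filter (fun x => s x < k + 1) =
          X.filter (fun x => s x < k) ∪ X.filter (fun x => s x = k) := by
        rw [← Finset.filter_or]
        exact Finset.filter_congr fun x _ => by omega
      have hdisj : Disjoint (X.filter fun x => s x < k) (X.filter fun x => s x = k) :=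
        Finset.disjoint_filter.2 fun x _ h => by omega
      have hcard := hs (k + 1)
      have hconst : ∑ x ∈ X.filter (fun x => s x = k), c (s x) =
          (X.filter fun x => s x = k).card * c k := by
        rw [Finset.sum_congr rfl fun x hx => by rw [(Finset.mem_filter.1 hx).2],
          Finset.sum_const, smul_eq_mul]
      have hk := hs k
      rw [hsplit, Finset.card_union_of_disjoint hdisj] at *
      rw [Finset.sum_union hdisj, hconst, Finset.sum_range_succ]
      set m := (X.filter fun x => s x = k).card
      set a := (X.filter fun x => s x < k).card
      have h1 : (k + 1 - (a + m)) * c (k + 1) ≤ (k + 1 - (a + m)) * c k :=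
        Nat.mul_le_mul_left _ (hc (Nat.le_succ k))
      have h2 : m * c k + (k + 1 - (a + m)) * c k = (k - a) * c k + c k := by
        rw [← add_mul, ← Nat.succ_mul]
        congr 1
        omega
      omega
  have := key N
  rw [Finset.filter_true_of_mem hN] at this
  omega

end Numeric

/-! ### Monotonicity and conjugacy of the two families of parameters -/

section Parameters

theorem antichainCover_mono (P : Type*) [PartialOrder P] [Fintype P] :
    Monotone (antichainCover P) :=
  maxCover_mono _ (Set.pairwise_empty _)

theorem chainCover_mono (P : Type*) [PartialOrder P] [Fintype P] : Monotone (chainCover P) :=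
  maxCover_mono _ (Set.pairwise_empty _)

theorem antichainParam_antitone (P : Type*) [PartialOrder P] [Fintype P] :
    Antitone (antichainParam P) :=
  antitone_sub_of_dual antichainCover_add_chainCover_le exists_chainCover_dual

theorem chainCover_add_antichainCover_le {P : Type*} [PartialOrder P] [Fintype P] (l k : ℕ) :
    chainCover P l + antichainCover P k ≤ Fintype.card P + l * k := by
  have := antichainCover_add_chainCover_le (T := P) k l
  rw [mul_comm k l] at this
  omega

theorem chainParam_antitone (P : Type*) [PartialOrder P] [Fintype P] :
    Antitone (chainParam P) := by
  refine antitone_sub_of_dual chainCover_add_antichainCover_le fun l => ?_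
  obtain ⟨k, hk⟩ := exists_antichainCover_dual (T := P) l
  refine ⟨k, ?_⟩
  rw [mul_comm k l] at hk
  omega

theorem succ_le_antichainParam_iff (P : Type*) [PartialOrder P] [Fintype P] (i j : ℕ) :
    i + 1 ≤ antichainParam P j ↔ j + 1 ≤ chainParam P i := by
  refine ⟨succ_le_sub_of_dual (antichainCover_mono P) (antichainParam_antitone P)
    antichainCover_add_chainCover_le exists_antichainCover_dual,
    succ_le_sub_of_dual (chainCover_mono P) (chainParam_antitone P)
    chainCover_add_antichainCover_le fun k => ?_⟩
  obtain ⟨l, hl⟩ := exists_chainCover_dual (T := P) k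
  refine ⟨l, ?_⟩
  rw [mul_comm k l] at hl
  omega

theorem conjAntichainParam_eq_chainParam (P : Type*) [PartialOrder P] [Fintype P] (i : ℕ) :
    conjAntichainParam P i = chainParam P i := by
  have h : (Finset.range (Fintype.card P)).filter (fun j => i + 1 ≤ antichainParam P j) =
      Finset.range (chainParam P i) := by
    ext j
    rw [Finset.mem_filter, Finset.mem_range, Finset.mem_range, succ_le_antichainParam_iff]
    refine ⟨fun h => h.2, fun h => ⟨?_, h⟩⟩
    by_contra! hj
    have := (succ_le_antichainParam_iff P i j).2 h
    rw [antichainParam_eq_zero P j hj] at this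
    omega
  rw [conjAntichainParam, h, Finset.card_range]

end Parameters

/-! ### Cover numbers of subsets and deletion of a point -/

section Subsets

theorem ncard_preimage_coe {P : Type*} {S : Finset P} {B : Set P} (hB : B ⊆ S) :
    ((fun x : S => (x : P)) ⁻¹' B).ncard = B.ncard := by
  rw [← Set.ncard_image_of_injective _ Subtype.val_injective, Set.image_preimage_eq_of_subset]
  intro x hx
  exact ⟨⟨x, hB hx⟩, rfl⟩

variable {P : Type*} [PartialOrder P]

theorem le_antichainCover_coe {S : Finset P} {ι : Type*} [Fintype ι] {k : ℕ}
    (hk : Fintype.card ι ≤ k) (A : ι → Set P) (hA : ∀ i, IsAntichain (· ≤ ·) (A i)) {B : Set P}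
    (hBS : B ⊆ S) (hB : B ⊆ ⋃ i, A i) : B.ncard ≤ antichainCover S k := by
  rw [← ncard_preimage_coe hBS]
  refine le_antichainCover hk (fun i => (fun x : S => (x : P)) ⁻¹' A i) (fun i => ?_) ?_
  · intro x hx y hy hxy hle
    exact hA i hx hy (fun h => hxy (Subtype.ext h)) hle
  · rw [← Set.preimage_iUnion]
    exact Set.preimage_mono hB

theorem le_chainCover_coe {S : Finset P} {ι : Type*} [Fintype ι] {k : ℕ}
    (hk : Fintype.card ι ≤ k) (A : ι → Set P) (hA : ∀ i, IsChain (· ≤ ·) (A i)) {B : Set P}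
    (hBS : B ⊆ S) (hB : B ⊆ ⋃ i, A i) : B.ncard ≤ chainCover S k := by
  rw [← ncard_preimage_coe hBS]
  refine le_chainCover hk (fun i => (fun x : S => (x : P)) ⁻¹' A i) (fun i => ?_) ?_
  · intro x hx y hy hxy
    exact hA i hx hy (fun h => hxy (Subtype.ext h))
  · rw [← Set.preimage_iUnion]
    exact Set.preimage_mono hB

theorem exists_antichainCover_coe (S : Finset P) (k : ℕ) :
    ∃ A : Fin k → Set P, (∀ i, IsAntichain (· ≤ ·) (A i)) ∧ (∀ i, A i ⊆ S) ∧
      (⋃ i, A i).ncard = antichainCover S k := by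
  obtain ⟨A, hA, hAc⟩ := exists_maxCover (P := S) (Q := fun A => IsAntichain (· ≤ ·) A)
    (Set.pairwise_empty _) k
  refine ⟨fun i => Subtype.val '' A i, fun i => ?_, fun i => ?_, ?_⟩
  · rintro _ ⟨x, hx, rfl⟩ _ ⟨y, hy, rfl⟩ hxy hle
    exact hA i hx hy (fun h => hxy (congrArg _ h)) hle
  · rintro _ ⟨x, -, rfl⟩
    exact x.2
  · rw [← Set.image_iUnion, Set.ncard_image_of_injective _ Subtype.val_injective]
    exact hAc

theorem exists_chainCover_coe (S : Finset P) (k : ℕ) :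
    ∃ A : Fin k → Set P, (∀ i, IsChain (· ≤ ·) (A i)) ∧ (∀ i, A i ⊆ S) ∧
      (⋃ i, A i).ncard = chainCover S k := by
  obtain ⟨A, hA, hAc⟩ := exists_maxCover (P := S) (Q := fun A => IsChain (· ≤ ·) A)
    (Set.pairwise_empty _) k
  refine ⟨fun i => Subtype.val '' A i, fun i => ?_, fun i => ?_, ?_⟩
  · rintro _ ⟨x, hx, rfl⟩ _ ⟨y, hy, rfl⟩ hxy
    exact hA i hx hy (fun h => hxy (congrArg _ h))
  · rintro _ ⟨x, -, rfl⟩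
    exact x.2
  · rw [← Set.image_iUnion, Set.ncard_image_of_injective _ Subtype.val_injective]
    exact hAc

theorem antichainCover_coe_univ [Fintype P] (k : ℕ) :
    antichainCover (Finset.univ : Finset P) k = antichainCover P k := by
  apply le_antisymm
  · obtain ⟨A, hA, -, hAc⟩ := exists_antichainCover_coe (Finset.univ : Finset P) k
    rw [← hAc]
    exact le_antichainCover (by simp) A hA subset_rfl
  · obtain ⟨A, hA, hAc⟩ := exists_maxCover (P := P) (Q := fun A => IsAntichain (· ≤ ·) A)
      (Set.pairwise_empty _) k
    rw [antichainCover, ← hAc]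
    exact le_antichainCover_coe (by simp) A hA (by simp) subset_rfl

theorem chainCover_coe_univ [Fintype P] (k : ℕ) :
    chainCover (Finset.univ : Finset P) k = chainCover P k := by
  apply le_antisymm
  · obtain ⟨A, hA, -, hAc⟩ := exists_chainCover_coe (Finset.univ : Finset P) k
    rw [← hAc]
    exact le_chainCover (by simp) A hA subset_rfl
  · obtain ⟨A, hA, hAc⟩ := exists_maxCover (P := P) (Q := fun A => IsChain (· ≤ ·) A)
      (Set.pairwise_empty _) k
    rw [chainCover, ← hAc]
    exact le_chainCover_coe (by simp) A hA (by simp) subset_rfl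

theorem antichainCover_coe_eq_card {S : Finset P} {k : ℕ} (hk : S.card ≤ k) :
    antichainCover S k = S.card := by
  have := maxCover_eq_card (P := S) (fun A => IsAntichain (· ≤ ·) A) (Set.pairwise_empty _)
    (fun x => Set.pairwise_singleton x _) k (by simpa using hk)
  rwa [Fintype.card_coe] at this

theorem chainCover_coe_eq_card {S : Finset P} {k : ℕ} (hk : S.card ≤ k) :
    chainCover S k = S.card := by
  have := maxCover_eq_card (P := S) (fun A => IsChain (· ≤ ·) A) (Set.pairwise_empty _)
    (fun x => Set.pairwise_singleton x _) k (by simpa using hk)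
  rwa [Fintype.card_coe] at this

variable [DecidableEq P]

theorem antichainCover_erase_le (S : Finset P) (x : P) (k : ℕ) :
    antichainCover (S.erase x) k ≤ antichainCover S k := by
  obtain ⟨A, hA, hAS, hAc⟩ := exists_antichainCover_coe (S.erase x) k
  rw [← hAc]
  exact le_antichainCover_coe (by simp) A hA
    (Set.iUnion_subset fun i => (hAS i).trans (by simp)) subset_rfl

theorem chainCover_erase_le (S : Finset P) (x : P) (k : ℕ) :
    chainCover (S.erase x) k ≤ chainCover S k := by
  obtain ⟨A, hA, hAS, hAc⟩ := exists_chainCover_coe (S.erase x) k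
  rw [← hAc]
  exact le_chainCover_coe (by simp) A hA
    (Set.iUnion_subset fun i => (hAS i).trans (by simp)) subset_rfl

theorem antichainCover_le_erase_add_one (S : Finset P) (x : P) (k : ℕ) :
    antichainCover S k ≤ antichainCover (S.erase x) k + 1 := by
  obtain ⟨A, hA, hAS, hAc⟩ := exists_antichainCover_coe S k
  rw [← hAc]
  refine (Set.ncard_le_ncard_sdiff_add_ncard _ {x}).trans ?_
  rw [Set.ncard_singleton]
  refine Nat.add_le_add_right (le_antichainCover_coe (by simp) A hA ?_ Set.sdiff_subset) 1
  rw [Finset.coe_erase]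
  exact Set.sdiff_subset_sdiff_left (Set.iUnion_subset hAS)

theorem chainCover_le_erase_add_one (S : Finset P) (x : P) (k : ℕ) :
    chainCover S k ≤ chainCover (S.erase x) k + 1 := by
  obtain ⟨A, hA, hAS, hAc⟩ := exists_chainCover_coe S k
  rw [← hAc]
  refine (Set.ncard_le_ncard_sdiff_add_ncard _ {x}).trans ?_
  rw [Set.ncard_singleton]
  refine Nat.add_le_add_right (le_chainCover_coe (by simp) A hA ?_ Set.sdiff_subset) 1
  rw [Finset.coe_erase]
  exact Set.sdiff_subset_sdiff_left (Set.iUnion_subset hAS)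

theorem chainCover_eq_erase_of_notMem {S : Finset P} {x : P} {k : ℕ} {C : Fin k → Set P}
    (hC : ∀ i, IsChain (· ≤ ·) (C i)) (hCS : ∀ i, C i ⊆ S)
    (hCc : (⋃ i, C i).ncard = chainCover S k) (hx : x ∉ ⋃ i, C i) :
    chainCover (S.erase x) k = chainCover S k := by
  refine le_antisymm (chainCover_erase_le S x k) ?_
  rw [← hCc]
  refine le_chainCover_coe (by simp) C hC (fun y hy => ?_) subset_rfl
  rw [Finset.coe_erase]
  exact ⟨Set.iUnion_subset hCS hy, fun h => hx (h ▸ hy)⟩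

end Subsets

/-! ### Recursion and antichain inequality for linear extensions -/

section LinearExtensions

variable {P : Type*} [PartialOrder P]

/-- The bijections of `S` onto `{0, ..., |S| - 1}` which reverse the order, extended by zero. -/
def reverseLabelings (S : Finset P) : Set (P → ℕ) :=
  {f | (∀ x ∉ S, f x = 0) ∧ (∀ x ∈ S, f x < S.card) ∧ Set.InjOn f S ∧ AntitoneOn f S}

/-- The number of linear extensions of the subset `S`. -/
noncomputable def numLabelings (S : Finset P) : ℕ :=
  (reverseLabelings S).ncard

/-- The minimal elements of `S`. -/
noncomputable def minimals (S : Finset P) : Finset P := by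
  classical
  exact S.filter fun x => ∀ y ∈ S, ¬ y < x

theorem mem_minimals {S : Finset P} {x : P} :
    x ∈ minimals S ↔ x ∈ S ∧ ∀ y ∈ S, ¬ y < x := by
  classical
  simp [minimals]

theorem reverseLabelings_finite [Finite P] (S : Finset P) : (reverseLabelings S).Finite := by
  refine Set.Finite.subset (Set.Finite.pi' (fun _ : P => Set.finite_Iic S.card)) ?_
  intro f hf x
  by_cases hx : x ∈ S
  · exact (hf.2.1 x hx).le
  · simp [hf.1 x hx]

theorem exists_eq_of_mem_reverseLabelings {S : Finset P} {f : P → ℕ}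
    (hf : f ∈ reverseLabelings S) {m : ℕ} (hm : m < S.card) : ∃ x ∈ S, f x = m := by
  classical
  have h : S.image f = Finset.range S.card := by
    refine Finset.eq_of_subset_of_card_le ?_ ?_
    · intro y hy
      obtain ⟨x, hx, rfl⟩ := Finset.mem_image.1 hy
      exact Finset.mem_range.2 (hf.2.1 x hx)
    · rw [Finset.card_range, Finset.card_image_of_injOn hf.2.2.1]
  exact Finset.mem_image.1 (h ▸ Finset.mem_range.2 hm)

theorem numLabelings_empty : numLabelings (∅ : Finset P) = 1 := by
  rw [numLabelings, Set.ncard_eq_one]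
  refine ⟨0, ?_⟩
  ext f
  simp only [Set.mem_singleton_iff]
  refine ⟨fun hf => funext fun x => hf.1 x (Finset.notMem_empty x), ?_⟩
  rintro rfl
  exact ⟨fun _ _ => rfl, by simp, by simp, fun _ _ _ _ _ => le_rfl⟩

theorem numLabelings_univ [Fintype P] :
    numLabelings (Finset.univ : Finset P) = numLinearExtensions P := by
  rw [numLabelings, numLinearExtensions, ← Nat.card_coe_set_eq]
  have hlt : ∀ f : reverseLabelings (Finset.univ : Finset P), ∀ x, f.1 x < Fintype.card P :=
    fun f x => f.2.2.1 x (Finset.mem_univ x)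
  refine Nat.card_eq_of_bijective (fun f => ⟨Equiv.ofBijective
    (fun x => Fin.rev ⟨f.1 x, hlt f x⟩) ?_, ?_⟩) ⟨?_, ?_⟩
  · rw [Fintype.bijective_iff_injective_and_card]
    refine ⟨fun x y h => ?_, by simp⟩
    have := congrArg Fin.val (Fin.rev_injective h)
    exact f.2.2.2.1 (by simp) (by simp) this
  · intro x y hxy
    exact Fin.rev_le_rev.2 (f.2.2.2.2 (by simp) (by simp) hxy)
  · intro f g h
    ext x
    have := congrArg (fun e => e.1 x) h
    exact congrArg Fin.val (Fin.rev_injective this)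
  · rintro ⟨e, he⟩
    refine ⟨⟨fun x => (Fin.rev (e x)).1, by simp, fun x _ => (Fin.rev (e x)).2,
      fun x _ y _ h => ?_, fun x _ y _ h => ?_⟩, ?_⟩
    · exact e.injective (Fin.rev_injective (Fin.ext h))
    · exact Fin.rev_le_rev.2 (he h)
    · ext x
      exact congrArg Fin.val (Fin.rev_rev (e x))

variable [DecidableEq P]

/-- With reversed labels the first element carries the largest label, so deleting it needs no
relabelling of the others. -/
theorem bijOn_update_reverseLabelings {S : Finset P} {x : P} (hx : x ∈ minimals S) :
    Set.BijOn (fun f => Function.update f x 0)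
      {f ∈ reverseLabelings S | f x = S.card - 1} (reverseLabelings (S.erase x)) := by
  obtain ⟨hxS, hmin⟩ := mem_minimals.1 hx
  have hcard : (S.erase x).card = S.card - 1 := Finset.card_erase_of_mem hxS
  refine ⟨?_, ?_, ?_⟩
  · rintro f ⟨⟨h0, hlt, hinj, hanti⟩, hfx⟩
    have hne : ∀ y ∈ S.erase x, Function.update f x 0 y = f y := fun y hy =>
      Function.update_of_ne (Finset.ne_of_mem_erase hy) _ _
    refine ⟨fun y hy => ?_, fun y hy => ?_, fun y hy z hz h => ?_, fun y hy z hz h => ?_⟩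
    · by_cases hyx : y = x
      · simp [hyx]
      · simp only [Function.update_of_ne hyx]
        exact h0 y fun h => hy (Finset.mem_erase.2 ⟨hyx, h⟩)
    · simp only [hne y hy, hcard]
      have h1 := hlt y (Finset.mem_of_mem_erase hy)
      have h2 : f y ≠ f x := fun h =>
        Finset.ne_of_mem_erase hy (hinj (Finset.mem_of_mem_erase hy) hxS h)
      omega
    · simp only at h
      rw [hne y hy, hne z hz] at h
      exact hinj (Finset.mem_of_mem_erase hy) (Finset.mem_of_mem_erase hz) h
    · simp only [hne y hy, hne z hz]
      exact hanti (Finset.mem_of_mem_erase hy) (Finset.mem_of_mem_erase hz) h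
  · rintro f ⟨-, hf⟩ g ⟨-, hg⟩ h
    ext y
    by_cases hyx : y = x
    · rw [hyx, hf, hg]
    · have := congrFun h y
      simpa [Function.update_of_ne hyx] using this
  · rintro g ⟨h0, hlt, hinj, hanti⟩
    rw [hcard] at hlt
    have hpos : 0 < S.card := Finset.card_pos.2 ⟨x, hxS⟩
    have hne : ∀ y, y ≠ x → Function.update g x (S.card - 1) y = g y := fun y hy =>
      Function.update_of_ne hy _ _
    have hgx : g x = 0 := h0 x (Finset.notMem_erase x S)
    refine ⟨Function.update g x (S.card - 1), ⟨⟨fun y hy => ?_, fun y hy => ?_,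
      fun y hy z hz h => ?_, fun y hy z hz h => ?_⟩, by simp⟩, ?_⟩
    · rw [hne y (fun h => hy (h ▸ hxS))]
      exact h0 y fun h => hy (Finset.mem_of_mem_erase h)
    · by_cases hyx : y = x
      · rw [hyx, Function.update_self]
        omega
      · rw [hne y hyx]
        have := hlt y (Finset.mem_erase.2 ⟨hyx, hy⟩)
        omega
    · by_cases hyx : y = x
      · by_cases hzx : z = x
        · rw [hyx, hzx]
        · have := hlt z (Finset.mem_erase.2 ⟨hzx, hz⟩)
          rw [hne z hzx, hyx, Function.update_self] at h
          omega
      · by_cases hzx : z = x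
        · have := hlt y (Finset.mem_erase.2 ⟨hyx, hy⟩)
          rw [hne y hyx, hzx, Function.update_self] at h
          omega
        · rw [hne y hyx, hne z hzx] at h
          exact hinj (Finset.mem_erase.2 ⟨hyx, hy⟩) (Finset.mem_erase.2 ⟨hzx, hz⟩) h
    · by_cases hzx : z = x
      · have : y = z := by
          by_contra hyz
          exact hmin y hy (hzx ▸ lt_of_le_of_ne h hyz)
        rw [this]
      · by_cases hyx : y = x
        · have := hlt z (Finset.mem_erase.2 ⟨hzx, hz⟩)
          rw [hne z hzx, hyx, Function.update_self]
          omega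
        · rw [hne y hyx, hne z hzx]
          exact hanti (Finset.mem_erase.2 ⟨hyx, hy⟩) (Finset.mem_erase.2 ⟨hzx, hz⟩) h
    · ext y
      by_cases hyx : y = x
      · simp [hyx, hgx]
      · simp [Function.update_of_ne hyx]

theorem numLabelings_eq_sum [Finite P] {S : Finset P} (hS : S.Nonempty) :
    numLabelings S = ∑ x ∈ minimals S, numLabelings (S.erase x) := by
  have hpos := Finset.card_pos.2 hS
  have hU : reverseLabelings S =
      ⋃ x ∈ minimals S, {f ∈ reverseLabelings S | f x = S.card - 1} := by
    ext f
    simp only [Set.mem_iUnion]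
    refine ⟨fun hf => ?_, fun ⟨x, _, hx⟩ => hx.1⟩
    obtain ⟨x, hxS, hfx⟩ := exists_eq_of_mem_reverseLabelings hf (m := S.card - 1) (by omega)
    refine ⟨x, mem_minimals.2 ⟨hxS, fun y hy hyx => ?_⟩, hf, hfx⟩
    have h1 := hf.2.2.2 hy hxS hyx.le
    have h2 := hf.2.1 y hy
    exact hyx.ne (hf.2.2.1 hy hxS (by omega))
  rw [numLabelings, hU]
  refine (Set.Finite.ncard_biUnion (minimals S).finite_toSet
    (fun x _ => (reverseLabelings_finite S).subset fun f hf => hf.1) ?_).trans ?_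
  · intro x hx y hy hxy
    refine Set.disjoint_left.2 fun f hf hf' => hxy ?_
    exact hf.1.2.2.1 (mem_minimals.1 hx).1 (mem_minimals.1 hy).1 (hf.2.trans hf'.2.symm)
  · rw [finsum_mem_coe_finset]
    exact Finset.sum_congr rfl fun x hx => (bijOn_update_reverseLabelings hx).ncard_eq

/-- The sum of the numbers of linear extensions of `S` without one element of an antichain is at
most the number of linear extensions of `S`. -/
theorem sum_numLabelings_erase_le [Finite P] (S B : Finset P) (hBS : B ⊆ S)
    (hB : IsAntichain (· ≤ ·) (B : Set P)) :
    ∑ x ∈ B, numLabelings (S.erase x) ≤ numLabelings S := by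
  induction hn : S.card generalizing S B with
  | zero =>
    have hS := Finset.card_eq_zero.1 hn
    rw [hS, Finset.subset_empty] at hBS
    simp [hBS]
  | succ n ih =>
    have hS : S.Nonempty := Finset.card_pos.1 (by omega)
    -- A single element is treated apart: the recursion below expands e(S∖x), which requires S∖x to
    -- be nonempty.
    rcases Nat.eq_zero_or_pos n with rfl | hpos
    · rw [numLabelings_eq_sum hS]
      refine Finset.sum_le_sum_of_subset fun x hx => mem_minimals.2 ⟨hBS hx, fun y hy hyx => ?_⟩
      exact hyx.ne (Finset.card_le_one.1 (by omega) y hy x (hBS hx))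
    -- The elements that become minimal when y is deleted: y is the only element of S below them.
    let N : P → Finset P := fun y => minimals (S.erase y) \ minimals S
    have hN : ∀ y z, z ∈ N y → z ∈ S ∧ z ≠ y ∧ y < z ∧ ∀ w ∈ S, w < z → w = y := by
      intro y z hz
      obtain ⟨h1, h2⟩ := Finset.mem_sdiff.1 hz
      obtain ⟨h3, h4⟩ := mem_minimals.1 h1
      have h5 : ∀ w ∈ S, w < z → w = y := fun w hw hwz => by
        by_contra hwy
        exact h4 w (Finset.mem_erase.2 ⟨hwy, hw⟩) hwz
      refine ⟨Finset.mem_of_mem_erase h3, Finset.ne_of_mem_erase h3, ?_, h5⟩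
      by_contra hyz
      refine h2 (mem_minimals.2 ⟨Finset.mem_of_mem_erase h3, fun w hw hwz => ?_⟩)
      exact hyz (h5 w hw hwz ▸ hwz)
    have hmin : ∀ y, minimals (S.erase y) = (minimals S).erase y ∪ N y := by
      intro y
      ext z
      simp only [N, Finset.mem_union, Finset.mem_erase, Finset.mem_sdiff, mem_minimals]
      constructor
      · rintro ⟨⟨h1, h2⟩, h3⟩
        by_cases hz : z ∈ S ∧ ∀ w ∈ S, ¬ w < z
        · exact Or.inl ⟨h1, hz⟩
        · exact Or.inr ⟨⟨⟨h1, h2⟩, h3⟩, hz⟩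
      · rintro (⟨h1, h2, h3⟩ | ⟨h, -⟩)
        · exact ⟨⟨h1, h2⟩, fun w hw => h3 w hw.2⟩
        · exact h
    have hNmin : ∀ y, y ∉ minimals S → N y = ∅ := by
      intro y hy
      rw [Finset.eq_empty_iff_forall_notMem]
      intro z hz
      obtain ⟨hzS, hzy, hyz, hall⟩ := hN y z hz
      by_cases hyS : y ∈ S
      · refine hy (mem_minimals.2 ⟨hyS, fun w hw hwy => hwy.ne (hall w hw (hwy.trans hyz))⟩)
      · exact (Finset.mem_sdiff.1 hz).2 (mem_minimals.2 ⟨hzS, fun w hw hwz =>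
          hyS (hall w hw hwz ▸ hw)⟩)
    -- The antichain for the induction in S∖y: if y belongs to B, the elements released by y replace
    -- it.
    let D : P → Finset P := fun y => if y ∈ B then B.erase y ∪ N y else B
    have hstep : ∀ y ∈ minimals S,
        ∑ x ∈ D y, numLabelings ((S.erase y).erase x) ≤ numLabelings (S.erase y) := by
      intro y hy
      have hyS := (mem_minimals.1 hy).1
      refine ih (S.erase y) (D y) ?_ ?_ (by rw [Finset.card_erase_of_mem hyS]; omega)
      · intro x hx
        simp only [D] at hx
        split_ifs at hx with h
        · rcases Finset.mem_union.1 hx with hx | hx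
          · exact Finset.erase_subset_erase y hBS hx
          · exact (mem_minimals.1 (Finset.mem_sdiff.1 hx).1).1
        · exact Finset.mem_erase.2 ⟨fun h' => h (h' ▸ hx), hBS hx⟩
      · simp only [D]
        split_ifs with h
        · intro a ha b hb hab hle
          have hlt : a < b := lt_of_le_of_ne hle hab
          rcases Finset.mem_union.1 (Finset.mem_coe.1 ha) with ha | ha
          · rcases Finset.mem_union.1 (Finset.mem_coe.1 hb) with hb | hb
            · exact hB (Finset.mem_of_mem_erase ha) (Finset.mem_of_mem_erase hb) hab hle
            · exact Finset.ne_of_mem_erase ha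
                ((hN y b hb).2.2.2 a (hBS (Finset.mem_of_mem_erase ha)) hlt)
          · have hya := (hN y a ha).2.2.1
            rcases Finset.mem_union.1 (Finset.mem_coe.1 hb) with hb | hb
            · exact hB h (Finset.mem_of_mem_erase hb) (hya.trans hlt).ne (hya.trans hlt).le
            · exact hya.ne ((hN y b hb).2.2.2 a (hN y a ha).1 hlt).symm
        · exact hB
    rw [numLabelings_eq_sum hS]
    refine le_trans (le_of_eq ?_) (Finset.sum_le_sum hstep)
    -- Both sides are now expanded over ordered pairs of deletions and agree: the old minimal
    -- elements match after exchanging the order of summation, and `N x` is empty unless x is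
    -- minimal.
    have hleft : ∀ x ∈ B, numLabelings (S.erase x) =
        ∑ y ∈ (minimals S).erase x, numLabelings ((S.erase y).erase x) +
          ∑ z ∈ N x, numLabelings ((S.erase x).erase z) := by
      intro x hx
      have hne : (S.erase x).Nonempty :=
        Finset.card_pos.1 (by rw [Finset.card_erase_of_mem (hBS hx)]; omega)
      rw [numLabelings_eq_sum hne, hmin, Finset.sum_union]
      · congr 1
        exact Finset.sum_congr rfl fun y _ => by rw [Finset.erase_right_comm]
      · exact Finset.disjoint_left.2 fun y hy hy' =>
          (Finset.mem_sdiff.1 hy').2 (Finset.mem_of_mem_erase hy)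
    have hright : ∀ y ∈ minimals S, ∑ x ∈ D y, numLabelings ((S.erase y).erase x) =
        ∑ x ∈ B.erase y, numLabelings ((S.erase y).erase x) +
          if y ∈ B then ∑ z ∈ N y, numLabelings ((S.erase y).erase z) else 0 := by
      intro y hy
      simp only [D]
      split_ifs with h
      · rw [Finset.sum_union]
        rw [Finset.disjoint_left]
        intro x hx hx'
        have := (hN y x hx').2.2.1
        exact hB h (Finset.mem_of_mem_erase hx) this.ne this.le
      · rw [Finset.erase_eq_of_notMem h, add_zero]
    rw [Finset.sum_congr rfl hleft, Finset.sum_congr rfl hright, Finset.sum_add_distrib,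
      Finset.sum_add_distrib]
    congr 1
    · refine Finset.sum_comm' fun x y => ?_
      simp only [Finset.mem_erase]
      tauto
    · rw [← Finset.sum_filter, Finset.filter_mem_eq_inter]
      symm
      refine Finset.sum_subset Finset.inter_subset_right fun x hx hx' => ?_
      rw [hNmin x fun h => hx' (Finset.mem_inter.2 ⟨h, hx⟩), Finset.sum_empty]

end LinearExtensions

/-! ### Height functions and persistence of drops under deletion -/

section Heights

variable {P : Type*} [PartialOrder P]

/-- The elements of `S` at which the function `h` is positive and strictly larger than at all
smaller elements of `S`. -/
def strictRises (S : Finset P) (h : P → ℕ) : Set P :=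
  {q | q ∈ S ∧ 0 < h q ∧ ∀ p ∈ S, p < q → h p < h q}

theorem strictRises_finite (S : Finset P) (h : P → ℕ) : (strictRises S h).Finite :=
  S.finite_toSet.subset fun _ hq => hq.1

/-- On the strict rises, each of the k positive levels of h is an antichain. -/
theorem ncard_strictRises_le {S : Finset P} {h : P → ℕ} {k : ℕ} (hk : ∀ q ∈ S, h q ≤ k) :
    (strictRises S h).ncard ≤ antichainCover S k := by
  refine le_antichainCover_coe (ι := Fin k) (by simp)
    (fun i => {q | q ∈ strictRises S h ∧ h q = i + 1}) (fun i p hp q hq hne hle => ?_)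
    (fun q hq => hq.1) fun q hq => ?_
  · have h1 := hq.1.2.2 p hp.1.1 (lt_of_le_of_ne hle hne)
    have h2 := hp.2
    have h3 := hq.2
    omega
  · have h1 := hq.2.1
    have h2 := hk q hq.1
    exact Set.mem_iUnion.2 ⟨⟨h q - 1, by omega⟩, hq, by simp only; omega⟩

theorem exists_antichainCover_le_ncard_strictRises (S : Finset P) (k : ℕ) :
    ∃ h : P → ℕ, MonotoneOn h S ∧ (∀ q ∈ S, h q ≤ k) ∧
      antichainCover S k ≤ (strictRises S h).ncard := by
  classical
  obtain ⟨A, hA, hAS, hAc⟩ := exists_antichainCover_coe S k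
  let ch : P → Finset (Finset P) := fun q =>
    S.powerset.filter fun c => IsChain (· ≤ ·) (c : Set P) ∧ ∀ x ∈ c, x ≤ q ∧ x ∈ ⋃ i, A i
  have hch : ∀ q c, c ∈ ch q ↔ c ⊆ S ∧ IsChain (· ≤ ·) (c : Set P) ∧
      ∀ x ∈ c, x ≤ q ∧ x ∈ ⋃ i, A i := fun q c => by
    simp only [ch, Finset.mem_filter, Finset.mem_powerset]
  -- The height of q is the size of a largest chain, among covered elements, lying weakly below q.
  -- It is at most k since a chain meets each antichain once, and it rises strictly at every covered
  -- element.
  refine ⟨fun q => (ch q).sup Finset.card, fun p hp q hq hpq => ?_, fun q hq => ?_, ?_⟩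
  · refine Finset.sup_mono fun c hc => ?_
    rw [hch] at hc ⊢
    exact ⟨hc.1, hc.2.1, fun x hx => ⟨(hc.2.2 x hx).1.trans hpq, (hc.2.2 x hx).2⟩⟩
  · refine Finset.sup_le fun c hc => ?_
    rw [hch] at hc
    have hi : ∀ x : c, ∃ i, x.1 ∈ A i := fun x => Set.mem_iUnion.1 (hc.2.2 x.1 x.2).2
    choose f hf using hi
    have hinj : Function.Injective f := by
      intro x y hxy
      by_contra hne
      have hne' : x.1 ≠ y.1 := fun h => hne (Subtype.ext h)
      have hx := hf x
      rw [hxy] at hx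
      rcases hc.2.1 x.2 y.2 hne' with h | h
      · exact hA _ hx (hf y) hne' h
      · exact hA _ (hf y) hx hne'.symm h
    simpa using Fintype.card_le_of_injective f hinj
  · rw [← hAc]
    refine Set.ncard_le_ncard (fun q hq => ?_) (strictRises_finite _ _)
    have hqS : q ∈ S := Set.iUnion_subset hAS hq
    refine ⟨hqS, ?_, fun p hp hpq => ?_⟩
    · have : {q} ∈ ch q := by
        rw [hch]
        refine ⟨by simpa using hqS, by simp [IsChain], fun x hx => ?_⟩
        rw [Finset.mem_singleton.1 hx]
        exact ⟨le_rfl, hq⟩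
      have := Finset.le_sup (f := Finset.card) this
      simpa using this
    · have hne : (ch p).Nonempty := ⟨∅, by rw [hch]; simp [IsChain]⟩
      obtain ⟨c, hc, hcard⟩ := Finset.exists_mem_eq_sup (ch p) hne Finset.card
      rw [hch] at hc
      have hqc : q ∉ c := fun h => (hc.2.2 q h).1.not_gt hpq
      have : insert q c ∈ ch q := by
        rw [hch]
        refine ⟨Finset.insert_subset hqS hc.1, ?_, fun x hx => ?_⟩
        · rw [Finset.coe_insert]
          exact hc.2.1.insert fun b hb _ => Or.inr ((hc.2.2 b hb).1.trans hpq.le)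
        · rcases Finset.mem_insert.1 hx with rfl | hx
          · exact ⟨le_rfl, hq⟩
          · exact ⟨(hc.2.2 x hx).1.trans hpq.le, (hc.2.2 x hx).2⟩
      have := Finset.le_sup (f := Finset.card) this
      rw [Finset.card_insert_of_notMem hqc] at this
      simp only [hcard]
      omega

/-- A rise of one function survives in the minimum where that function is the smaller and in the
maximum where it is the larger; a common rise survives in both. -/
theorem ncard_strictRises_add_le {S : Finset P} {h g : P → ℕ} (hh : MonotoneOn h S)
    (hg : MonotoneOn g S) :
    (strictRises S h).ncard + (strictRises S g).ncard ≤
      (strictRises S (h ⊓ g)).ncard + (strictRises S (h ⊔ g)).ncard := by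
  have fin := strictRises_finite S
  rw [← Set.ncard_union_add_ncard_inter (strictRises S h) _ (fin _) (fin _),
    ← Set.ncard_union_add_ncard_inter (strictRises S (h ⊓ g)) _ (fin _) (fin _)]
  refine add_le_add (Set.ncard_le_ncard ?_ ((fin _).union (fin _)))
    (Set.ncard_le_ncard ?_ ((fin _).inter_of_left _))
  · rintro q (hq | hq)
    · rcases le_or_gt (h q) (g q) with hle | hle
      · refine Or.inl ⟨hq.1, ?_, fun p hp hpq => ?_⟩
        · simpa [hle] using hq.2.1
        · have := hq.2.2 p hp hpq
          simp [hle, this]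
      · refine Or.inr ⟨hq.1, ?_, fun p hp hpq => ?_⟩
        · simp [hq.2.1]
        · have h1 := hq.2.2 p hp hpq
          have h2 := hg hp hq.1 hpq.le
          simp only [Pi.sup_apply]
          omega
    · rcases lt_or_ge (h q) (g q) with hle | hle
      · refine Or.inr ⟨hq.1, ?_, fun p hp hpq => ?_⟩
        · simp [hq.2.1]
        · have h1 := hq.2.2 p hp hpq
          have h2 := hh hp hq.1 hpq.le
          simp only [Pi.sup_apply]
          omega
      · refine Or.inl ⟨hq.1, ?_, fun p hp hpq => ?_⟩
        · simpa [hle] using hq.2.1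
        · have := hq.2.2 p hp hpq
          simp [hle, this]
  · rintro q ⟨hq, hq'⟩
    have h1 := hq.2.1
    have h2 := hq'.2.1
    refine ⟨⟨hq.1, ?_, fun p hp hpq => ?_⟩, ⟨hq.1, ?_, fun p hp hpq => ?_⟩⟩
    · simp [h1, h2]
    · have h3 := hq.2.2 p hp hpq
      have h4 := hq'.2.2 p hp hpq
      simp only [Pi.inf_apply]
      omega
    · simp [h1]
    · have h3 := hq.2.2 p hp hpq
      have h4 := hq'.2.2 p hp hpq
      simp only [Pi.sup_apply]
      omega

variable [DecidableEq P]

/-- Apply the exchange inequality to an optimal height h for (S, k) and one for (S∖x, m), extended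
by 0 at x. The minimum vanishes at x, so its rises count for (S∖x, k); the maximum is bounded by m.
Minimality of x keeps the extension monotone. -/
theorem antichainCover_erase_add_one_of_le {S : Finset P} {x : P} (hx : x ∈ minimals S)
    {k m : ℕ} (hkm : k ≤ m) (hk : antichainCover (S.erase x) k + 1 = antichainCover S k) :
    antichainCover (S.erase x) m + 1 = antichainCover S m := by
  obtain ⟨hxS, hmin⟩ := mem_minimals.1 hx
  obtain ⟨h, hh, hhk, hhA⟩ := exists_antichainCover_le_ncard_strictRises S k
  obtain ⟨g, hg, hgm, hgA⟩ := exists_antichainCover_le_ncard_strictRises (S.erase x) m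
  have hxh : x ∈ strictRises S h := by
    by_contra hxh
    have h1 : strictRises S h ⊆ strictRises (S.erase x) h := fun q hq =>
      ⟨Finset.mem_erase.2 ⟨fun e => hxh (e ▸ hq), hq.1⟩, hq.2.1,
        fun p hp => hq.2.2 p (Finset.mem_of_mem_erase hp)⟩
    have h2 := Set.ncard_le_ncard h1 (strictRises_finite _ _)
    have h3 := ncard_strictRises_le (S := S.erase x) (h := h) (k := k)
      fun q hq => hhk q (Finset.mem_of_mem_erase hq)
    omega
  set g' := Function.update g x 0 with hg'
  have hgx : g' x = 0 := by simp [hg']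
  have hne : ∀ y, y ≠ x → g' y = g y := fun y hy => Function.update_of_ne hy _ _
  have hg'mono : MonotoneOn g' S := by
    intro p hp q hq hpq
    by_cases hpx : p = x
    · rw [hpx, hgx]
      exact Nat.zero_le _
    · have hqx : q ≠ x := by
        rintro rfl
        exact hmin p hp (lt_of_le_of_ne hpq hpx)
      rw [hne p hpx, hne q hqx]
      exact hg (Finset.mem_erase.2 ⟨hpx, hp⟩) (Finset.mem_erase.2 ⟨hqx, hq⟩) hpq
  have h1 : (strictRises (S.erase x) g).ncard ≤ (strictRises S g').ncard := by
    refine Set.ncard_le_ncard (fun q hq => ?_) (strictRises_finite _ _)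
    have hqx := Finset.ne_of_mem_erase hq.1
    refine ⟨Finset.mem_of_mem_erase hq.1, by rw [hne q hqx]; exact hq.2.1, fun p hp hpq => ?_⟩
    rw [hne q hqx]
    by_cases hpx : p = x
    · rw [hpx, hgx]
      exact hq.2.1
    · rw [hne p hpx]
      exact hq.2.2 p (Finset.mem_erase.2 ⟨hpx, hp⟩) hpq
  have h2 : (strictRises S (h ⊓ g')).ncard ≤ antichainCover (S.erase x) k := by
    refine le_trans (Set.ncard_le_ncard (t := strictRises (S.erase x) (h ⊓ g')) (fun q hq => ?_)
      (strictRises_finite _ _)) (ncard_strictRises_le fun q hq => ?_)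
    · refine ⟨Finset.mem_erase.2 ⟨?_, hq.1⟩, hq.2.1,
        fun p hp => hq.2.2 p (Finset.mem_of_mem_erase hp)⟩
      rintro rfl
      have := hq.2.1
      simp [hgx] at this
    · exact (inf_le_left : (h ⊓ g') q ≤ h q).trans (hhk q (Finset.mem_of_mem_erase hq))
  have h3 : (strictRises S (h ⊔ g')).ncard ≤ antichainCover S m := by
    refine ncard_strictRises_le fun q hq => sup_le ((hhk q hq).trans hkm) ?_
    by_cases hqx : q = x
    · rw [hqx, hgx]
      exact Nat.zero_le _
    · rw [hne q hqx]
      exact hgm q (Finset.mem_erase.2 ⟨hqx, hq⟩)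
  have h4 := ncard_strictRises_add_le hh hg'mono
  have h5 := antichainCover_le_erase_add_one S x m
  omega

/-- If the drop at j vanished at j + 1, let m be a partner of j in S∖x and k one of j + 1 in S.
Duality then shows that the antichain number drops at k but not at m, while k ≤ m, against the
preceding persistence. -/
theorem chainCover_erase_succ_add_one {S : Finset P} {x : P} (hx : x ∈ minimals S) {j : ℕ}
    (hj : chainCover (S.erase x) j + 1 = chainCover S j) :
    chainCover (S.erase x) (j + 1) + 1 = chainCover S (j + 1) := by
  have hxS := (mem_minimals.1 hx).1
  have hcard : (S.erase x).card + 1 = S.card := Finset.card_erase_add_one hxS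
  have hle := chainCover_erase_le S x (j + 1)
  have hle' := chainCover_le_erase_add_one S x (j + 1)
  by_contra hne
  obtain ⟨m, hm⟩ := exists_antichainCover_dual (T := S.erase x) j
  obtain ⟨k, hk⟩ := exists_antichainCover_dual (T := S) (j + 1)
  have hw1 := antichainCover_add_chainCover_le (T := S) k j
  have hw2 := antichainCover_add_chainCover_le (T := S) m j
  have hw3 := antichainCover_add_chainCover_le (T := S.erase x) m (j + 1)
  have hw4 := antichainCover_add_chainCover_le (T := S.erase x) k (j + 1)
  simp only [Fintype.card_coe, mul_add, mul_one] at *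
  have hD := antichainCover_le_erase_add_one S x k
  have := antichainCover_erase_add_one_of_le hx (k := k) (m := m) (by omega) (by omega)
  omega

theorem chainCover_erase_add_one_of_le {S : Finset P} {x : P} (hx : x ∈ minimals S) {k m : ℕ}
    (hkm : k ≤ m) (hk : chainCover (S.erase x) k + 1 = chainCover S k) :
    chainCover (S.erase x) m + 1 = chainCover S m := by
  induction m, hkm using Nat.le_induction with
  | base => exact hk
  | succ m _ ih => exact chainCover_erase_succ_add_one hx ih

/-- Such elements lie in every optimal family of k chains, and a chain contains at most one minimal
element of S. -/
theorem card_minimals_chainCover_erase_le (S : Finset P) (k : ℕ) :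
    ((minimals S).filter fun x => chainCover (S.erase x) k + 1 = chainCover S k).card ≤ k := by
  obtain ⟨C, hC, hCS, hCc⟩ := exists_chainCover_coe S k
  have h : ∀ x : ↥((minimals S).filter fun x => chainCover (S.erase x) k + 1 = chainCover S k),
      ∃ i, x.1 ∈ C i := by
    intro x
    by_contra hx
    have := chainCover_eq_erase_of_notMem hC hCS hCc (fun h => hx (Set.mem_iUnion.1 h))
    have := (Finset.mem_filter.1 x.2).2
    omega
  choose f hf using h
  have hinj : Function.Injective f := by
    intro x y hxy
    by_contra hne
    have hne' : x.1 ≠ y.1 := fun h => hne (Subtype.ext h)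
    have hx := hf x
    rw [hxy] at hx
    have hxm := mem_minimals.1 (Finset.mem_filter.1 x.2).1
    have hym := mem_minimals.1 (Finset.mem_filter.1 y.2).1
    rcases hC _ hx (hf y) hne' with h | h
    · exact hym.2 x.1 hxm.1 (lt_of_le_of_ne h hne')
    · exact hxm.2 y.1 hym.1 (lt_of_le_of_ne h hne'.symm)
  simpa using Fintype.card_le_of_injective f hinj

end Heights

/-! ### The two bounds by induction on the subset -/

section Bounds

variable {P : Type*} [PartialOrder P]

theorem chainCover_zero (T : Type*) [PartialOrder T] [Fintype T] : chainCover T 0 = 0 :=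
  maxCover_zero _ (Set.pairwise_empty _)

theorem antichainCover_zero (T : Type*) [PartialOrder T] [Fintype T] : antichainCover T 0 = 0 :=
  maxCover_zero _ (Set.pairwise_empty _)

theorem prod_antichainParam_le_numLabelings [Finite P] (S : Finset P) {N : ℕ} (hN : S.card ≤ N) :
    ∏ i ∈ Finset.range N, (antichainParam S i).factorial ≤ numLabelings S := by
  classical
  induction hn : S.card generalizing S with
  | zero =>
    rw [Finset.card_eq_zero.1 hn, numLabelings_empty]
    refine le_of_eq (Finset.prod_eq_one fun i _ => ?_)
    rw [antichainParam_eq_zero _ _ (by simp), Nat.factorial_zero]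
  | succ n ih =>
    obtain ⟨A, hA, hAS, hAc⟩ := exists_antichainCover_coe S 1
    obtain ⟨B, hB⟩ : ∃ B : Finset P, (B : Set P) = A 0 :=
      (S.finite_toSet.subset (hAS 0)).exists_finset_coe
    have hBS : B ⊆ S := by
      rw [← Finset.coe_subset, hB]
      exact hAS 0
    have hBc : B.card = antichainCover S 1 := by
      rw [← hAc, ← Set.ncard_coe_finset, hB]
      congr 1
      ext x
      simp [Fin.exists_fin_one]
    have hpos : 0 < antichainCover S 1 := by
      obtain ⟨x, hx⟩ : S.Nonempty := Finset.card_pos.1 (by omega)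
      have := le_antichainCover_coe (S := S) (k := 1) (ι := Fin 1) (by simp) (fun _ => {x})
        (fun _ => Set.pairwise_singleton x _) (B := {x}) (by simpa using hx)
        (fun y hy => Set.mem_iUnion.2 ⟨0, hy⟩)
      rw [Set.ncard_singleton] at this
      omega
    have h0 : antichainParam S 0 = antichainCover S 1 := by
      rw [antichainParam, antichainCover_zero, Nat.sub_zero]
    have hstep : ∀ x ∈ B, ∏ i ∈ Finset.range N, (antichainParam S i).factorial ≤
        numLabelings (S.erase x) * antichainCover S 1 := by
      intro x hx
      have hcard : (S.erase x).card + 1 = S.card := Finset.card_erase_add_one (hBS hx)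
      -- Taking s = 0 gives the factor a_1 for every x, wherever the first drop occurs; this equals
      -- the number of elements of B.
      have hbox := prod_factorial_le_of_box (s := 0) (N := N) (antichainCover_mono S)
        (antichainCover_mono (S.erase x)) (antichainParam_antitone S)
        (antichainCover_erase_le S x) (antichainCover_le_erase_add_one S x) (Nat.zero_le N)
        (fun k hk => by
          rw [Nat.le_zero.1 hk, antichainCover_zero, antichainCover_zero])
        (by rw [antichainCover_coe_eq_card hN, antichainCover_coe_eq_card (by omega), hcard])
      refine hbox.trans ?_
      rw [zero_add, antichainCover_zero, Nat.sub_zero]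
      exact Nat.mul_le_mul_right _ (ih (S.erase x) (by omega) (by omega))
    have hsum := Finset.card_nsmul_le_sum B _ _ hstep
    rw [← Finset.sum_mul, smul_eq_mul, hBc, mul_comm] at hsum
    refine (Nat.le_of_mul_le_mul_right hsum hpos).trans (sum_numLabelings_erase_le S B hBS ?_)
    rw [hB]
    exact hA 0

theorem numLabelings_mul_prod_chainParam_le [Finite P] (S : Finset P) {N : ℕ} (hN : S.card ≤ N) :
    numLabelings S * ∏ i ∈ Finset.range N, (chainParam S i).factorial ≤ S.card.factorial := by
  classical
  induction hn : S.card generalizing S with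
  | zero =>
    rw [Finset.card_eq_zero.1 hn, numLabelings_empty]
    rw [Finset.prod_eq_one fun i _ => ?_]
    · simp
    rw [chainParam_eq_zero _ _ (by simp), Nat.factorial_zero]
  | succ n ih =>
    have hS : S.Nonempty := Finset.card_pos.1 (by omega)
    have hex : ∀ x ∈ minimals S, chainCover (S.erase x) N + 1 = chainCover S N := by
      intro x hx
      have hcard : (S.erase x).card + 1 = S.card :=
        Finset.card_erase_add_one (mem_minimals.1 hx).1
      rw [chainCover_coe_eq_card hN, chainCover_coe_eq_card (by omega), hcard]
    -- The shift by one makes `s x` the zero-based index of the parameter at which the first drop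
    -- happens. For minimal x the set is nonempty because N chains cover everything.
    let s : P → ℕ := fun x => sInf {k | chainCover (S.erase x) (k + 1) + 1 = chainCover S (k + 1)}
    have hN0 : N = N - 1 + 1 := by omega
    have hsmem : ∀ x ∈ minimals S,
        chainCover (S.erase x) (s x + 1) + 1 = chainCover S (s x + 1) := fun x hx =>
      Nat.sInf_mem (s := {k | chainCover (S.erase x) (k + 1) + 1 = chainCover S (k + 1)})
        ⟨N - 1, by
          have := hex x hx
          rwa [hN0] at this⟩
    have hsN : ∀ x ∈ minimals S, s x < N := by
      intro x hx
      have : s x ≤ N - 1 := Nat.sInf_le (by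
        have := hex x hx
        rwa [hN0] at this)
      omega
    have hseq : ∀ x, ∀ k ≤ s x, chainCover (S.erase x) k = chainCover S k := by
      intro x k hk
      cases k with
      | zero => rw [chainCover_zero, chainCover_zero]
      | succ k =>
        have h1 := Nat.notMem_of_lt_sInf (show k < sInf _ from hk)
        have h2 := chainCover_erase_le S x (k + 1)
        have h3 := chainCover_le_erase_add_one S x (k + 1)
        have h4 : ¬ chainCover (S.erase x) (k + 1) + 1 = chainCover S (k + 1) := h1
        omega
    have hstep : ∀ x ∈ minimals S,
        numLabelings (S.erase x) * ∏ i ∈ Finset.range N, (chainParam S i).factorial ≤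
          n.factorial * chainParam S (s x) := by
      intro x hx
      have hcard : (S.erase x).card + 1 = S.card :=
        Finset.card_erase_add_one (mem_minimals.1 hx).1
      have hbox := prod_factorial_le_of_box (N := N) (chainCover_mono S)
        (chainCover_mono (S.erase x)) (chainParam_antitone S)
        (chainCover_erase_le S x) (chainCover_le_erase_add_one S x) (hsN x hx).le (hseq x)
        (hex x hx)
      calc _ ≤ numLabelings (S.erase x) *
            ((∏ i ∈ Finset.range N, (chainParam (S.erase x) i).factorial) * chainParam S (s x)) :=
            Nat.mul_le_mul_left _ hbox
        _ = numLabelings (S.erase x) *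
            (∏ i ∈ Finset.range N, (chainParam (S.erase x) i).factorial) * chainParam S (s x) := by
            ring
        _ ≤ _ := by
            refine Nat.mul_le_mul_right _ ?_
            have h1 : (S.erase x).card = n := by omega
            have := ih (S.erase x) (by omega) h1
            exact this
    have hcount : ∀ k, ((minimals S).filter fun x => s x < k).card ≤ k := by
      intro k
      refine le_trans (Finset.card_le_card fun x hx => ?_) (card_minimals_chainCover_erase_le S k)
      obtain ⟨hx, hxk⟩ := Finset.mem_filter.1 hx
      -- By persistence a first drop at or before k is still present at k, where only k minimal
      -- elements can cause it.
      exact Finset.mem_filter.2 ⟨hx, chainCover_erase_add_one_of_le hx hxk (hsmem x hx)⟩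
    have hsum := sum_antitone_comp_le (minimals S) s (chainParam_antitone S) hcount hsN
    rw [sum_chainParam, chainCover_coe_eq_card hN] at hsum
    rw [numLabelings_eq_sum hS, Finset.sum_mul]
    refine (Finset.sum_le_sum hstep).trans ?_
    rw [← Finset.mul_sum, Nat.factorial_succ, ← hn, mul_comm S.card]
    exact Nat.mul_le_mul_left _ hsum

end Bounds

theorem theorem1 (P : Type*) [PartialOrder P] [Fintype P] :
    ((numLinearExtensions P : ℚ) ≤
        ((Fintype.card P).factorial : ℚ) /
          ∏ i ∈ Finset.range (Fintype.card P), ((chainParam P i).factorial : ℚ)) ∧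
    ((numLinearExtensions P : ℚ) ≤
        ((Fintype.card P).factorial : ℚ) /
          ∏ i ∈ Finset.range (Fintype.card P), ((conjAntichainParam P i).factorial : ℚ)) ∧
    (∏ i ∈ Finset.range (Fintype.card P), (antichainParam P i).factorial ≤
        numLinearExtensions P) := by
  have ha : ∀ i, antichainParam (Finset.univ : Finset P) i = antichainParam P i := fun i => by
    simp only [antichainParam, antichainCover_coe_univ]
  have hc : ∀ i, chainParam (Finset.univ : Finset P) i = chainParam P i := fun i => by
    simp only [chainParam, chainCover_coe_univ]
  have hupper : (numLinearExtensions P : ℚ) ≤ ((Fintype.card P).factorial : ℚ) /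
      ∏ i ∈ Finset.range (Fintype.card P), ((chainParam P i).factorial : ℚ) := by
    rw [le_div_iff₀ (Finset.prod_pos fun i _ => by exact_mod_cast Nat.factorial_pos _)]
    have := numLabelings_mul_prod_chainParam_le (Finset.univ : Finset P)
      (N := Fintype.card P) (by simp)
    simp only [hc, numLabelings_univ, Finset.card_univ] at this
    exact_mod_cast this
  refine ⟨hupper, ?_, ?_⟩
  · simpa only [conjAntichainParam_eq_chainParam] using hupper
  · have := prod_antichainParam_le_numLabelings (Finset.univ : Finset P)
      (N := Fintype.card P) (by simp)
    simpa only [ha, numLabelings_univ] using this
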